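/- Let $V\subset\mathbb R^n$ and $W\subset\mathbb R^m$ be open subsets, let $\varphi\colon V\to W$ be a smooth ($C^\infty$) map, let $\mathcal S$ be a Whitney stratification of a subset $X\subset V$ such that for every $S\in\mathcal S$ the restriction $\varphi|_S\colon S\to W$ is a submersion, and let $\mathcal T$ be a Whitney stratification of $W$. Then $$\mathcal S'=\{S\cap\varphi^{-1}(T) : S\in\mathcal S,\ T\in\mathcal T\}$$ is also a Whitney stratification of $X$. Here a Whitney stratification of a subset $X$ of a Euclidean space is a partition of $X$ into smooth embedded submanifolds (the strata; they need not be connected, and empty members of the family are disregarded) such that every point of $X$ has a neighbourhood that meets only finitely many strata, and such that for any two distinct strata $A,B$ the stratum $B$ is Whitney regular over $A$ at every point $x\in A$: whenever $a_k\in A$ and $b_k\in B$ are sequences with $a_k\ne b_k$ that converge to $x$, the lines through the origin parallel to $a_k-b_k$ converge to a line $L$, and the tangent spaces $T_{b_k}B$ converge to a linear subspace $E$ (in the corresponding Grassmannians), one has $L\subset E$. -/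

import Mathlib

open scoped ContDiff Topology

noncomputable section

namespace WhitneyStrat

variable {E F : Type*} [NormedAddCommGroup E] [InnerProductSpace ℝ E] [FiniteDimensional ℝ E]
  [NormedAddCommGroup F] [InnerProductSpace ℝ F] [FiniteDimensional ℝ F]

/-- `S` is an (embedded, not necessarily closed or connected) smooth submanifold of codimension `c`
of the Euclidean space `E`: near each of its points, `S` is the zero set of a smooth submersion
to `ℝ^c`. The empty set is a submanifold. -/
def IsSubmanifoldOfCodim (c : ℕ) (S : Set E) : Prop :=
  ∀ x ∈ S, ∃ (U : Set E) (g : E → EuclideanSpace ℝ (Fin c)),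
    IsOpen U ∧ x ∈ U ∧ ContDiffOn ℝ ∞ g U ∧
    (∀ y ∈ U, Function.Surjective (fderiv ℝ g y)) ∧ S ∩ U = {y ∈ U | g y = 0}

/-- `S` is a smooth submanifold of the Euclidean space `E` (of some dimension). -/
def IsSubmanifold (S : Set E) : Prop :=
  ∃ c : ℕ, IsSubmanifoldOfCodim c S

/-- The tangent space `T_x S`, as a linear subspace of the ambient space: the subspace spanned by
the directions tangent to `S` at `x`. If `S` is a submanifold, these directions already form a
linear subspace, the kernel of the differential of any local equation of `S`; see
`tangentSpace_eq_ker`. -/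
def tangentSpace (S : Set E) (x : E) : Submodule ℝ E :=
  Submodule.span ℝ (tangentConeAt ℝ S x)

/-- For a submanifold `S` with local equation `g = 0`, the directions tangent to `S` at `x` form
the kernel of the differential of `g`, which is therefore the tangent space. -/
theorem tangentSpace_eq_ker {c : ℕ} {S U : Set E} {g : E → EuclideanSpace ℝ (Fin c)} {x : E}
    (hU : IsOpen U) (hx : x ∈ S ∩ U) (hg : ContDiffOn ℝ ∞ g U)
    (hs : ∀ y ∈ U, Function.Surjective (fderiv ℝ g y)) (hSU : S ∩ U = {y ∈ U | g y = 0}) :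
    tangentConeAt ℝ S x = {v | fderiv ℝ g x v = 0} ∧
      tangentSpace S x = LinearMap.ker (fderiv ℝ g x : E →ₗ[ℝ] EuclideanSpace ℝ (Fin c)) := by
  have hcomp : CompleteSpace E := FiniteDimensional.complete ℝ E
  have hUx : U ∈ 𝓝 x := hU.mem_nhds hx.2
  have hgx : g x = 0 := by
    have h := hx
    rw [hSU] at h
    exact h.2
  have hst : HasStrictFDerivAt g (fderiv ℝ g x) x :=
    (hg.contDiffAt hUx).hasStrictFDerivAt (by simp)
  have key : tangentConeAt ℝ S x = {v | fderiv ℝ g x v = 0} := by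
    apply Set.Subset.antisymm
    · intro v hv
      rw [← tangentConeAt_inter_nhds hUx] at hv
      have h1 := hst.hasFDerivAt.hasFDerivWithinAt.mapsTo_tangent_cone (s := S ∩ U) hv
      have h2 : g '' (S ∩ U) ⊆ {0} := by
        rintro _ ⟨y, hy, rfl⟩
        rw [hSU] at hy
        exact hy.2
      have h3 := tangentConeAt_mono h2 h1
      rw [hgx] at h3
      have h4 := tangentConeAt_subset_zero (𝕜 := ℝ) (s := {(0 : EuclideanSpace ℝ (Fin c))})
        (x := 0) (fun h => by simpa using accPt_iff_nhds.1 h Set.univ Filter.univ_mem) h3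
      simpa using h4
    · intro v hv
      have hr : (fderiv ℝ g x).range = ⊤ := LinearMap.range_eq_top.2 (hs x hx.2)
      have hψ := hst.to_implicitFunction hr
      have hψ0 : hst.implicitFunction g _ hr (g x) 0 = x := by
        have := (hst.implicitToOpenPartialHomeomorph g _ hr).left_inv
          (hst.mem_implicitToOpenPartialHomeomorph_source hr)
        rwa [hst.implicitToOpenPartialHomeomorph_self hr] at this
      have hmem : ∀ᶠ z in 𝓝 (0 : (fderiv ℝ g x).ker),
          hst.implicitFunction g _ hr (g x) z ∈ S := by
        have e1 : ∀ᶠ z in 𝓝 (0 : (fderiv ℝ g x).ker),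
            g (hst.implicitFunction g _ hr (g x) z) = g x :=
          (Continuous.prodMk_right (g x)).tendsto (0 : (fderiv ℝ g x).ker)
            |>.eventually (hst.map_implicitFunction_eq hr)
        have e2 : ∀ᶠ z in 𝓝 (0 : (fderiv ℝ g x).ker),
            hst.implicitFunction g _ hr (g x) z ∈ U := by
          have := hψ.continuousAt.eventually (p := fun y => y ∈ U) (by rw [hψ0]; exact hUx)
          exact this
        filter_upwards [e1, e2] with z h1 h2
        have : hst.implicitFunction g _ hr (g x) z ∈ S ∩ U := by
          rw [hSU]
          exact ⟨h2, h1.trans hgx⟩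
        exact this.1
      have h1 := (hψ.hasFDerivAt.hasFDerivWithinAt
        (s := {z | hst.implicitFunction g _ hr (g x) z ∈ S})).mapsTo_tangent_cone
      rw [hψ0] at h1
      have h2 : (⟨v, hv⟩ : (fderiv ℝ g x).ker) ∈
          tangentConeAt ℝ {z | hst.implicitFunction g _ hr (g x) z ∈ S} 0 := by
        have h3 := tangentConeAt_inter_nhds (𝕜 := ℝ) (s := Set.univ) hmem
        rw [Set.univ_inter] at h3
        have h4 : (⟨v, hv⟩ : (fderiv ℝ g x).ker) ∈
          tangentConeAt ℝ (Set.univ : Set (fderiv ℝ g x).ker) 0 := by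
          rw [tangentConeAt_univ]; trivial
        rw [← h3] at h4
        exact h4
      have h5 := h1 h2
      refine tangentConeAt_mono ?_ h5
      rintro _ ⟨z, hz, rfl⟩
      exact hz
  refine ⟨key, ?_⟩
  rw [tangentSpace, key]
  exact Submodule.span_eq
    (LinearMap.ker (fderiv ℝ g x : E →ₗ[ℝ] EuclideanSpace ℝ (Fin c)))

/-- For a map `φ` that is smooth near the submanifold `S`, the restriction `φ|_S` is a submersion
to (an open subset of) `F`: its differential `T_x S → F` is onto at every point `x` of `S`. -/
def IsSubmersiveOn (φ : E → F) (S : Set E) : Prop :=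
  ∀ x ∈ S, Submodule.map (fderiv ℝ φ x : E →ₗ[ℝ] F) (tangentSpace S x) = ⊤

/-- Convergence in the Grassmannian of linear subspaces of the Euclidean space `E`: the orthogonal
projections converge in norm. (The dimensions are then eventually constant.) -/
def GrassTendsto (P : ℕ → Submodule ℝ E) (Q : Submodule ℝ E) : Prop :=
  Filter.Tendsto (fun k => (P k).starProjection) Filter.atTop (𝓝 Q.starProjection)

/-- `B` is Whitney regular over `A` at `x` (Whitney's condition (b)): if `a k ∈ A` and `b k ∈ B`
converge to `x`, the secant lines through `a k ≠ b k` converge to a line `L` and the tangent spaces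
of `B` at `b k` converge to a subspace `P`, then `L ⊆ P`. -/
def IsWhitneyRegularAt (B A : Set E) (x : E) : Prop :=
  ∀ (a b : ℕ → E) (L P : Submodule ℝ E),
    (∀ k, a k ∈ A) → (∀ k, b k ∈ B) → (∀ k, a k ≠ b k) →
    Filter.Tendsto a Filter.atTop (𝓝 x) → Filter.Tendsto b Filter.atTop (𝓝 x) →
    GrassTendsto (fun k => Submodule.span ℝ {a k - b k}) L →
    GrassTendsto (fun k => tangentSpace B (b k)) P →
    L ≤ P

/-- `𝒮` is a Whitney stratification of the subset `X` of the Euclidean space `E`: a locally finite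
partition of `X` into smooth submanifolds, the strata, each of which is Whitney regular over every
other one at each point of the latter. The empty set is tolerated as a member of `𝒮`. -/
structure IsWhitneyStratification (𝒮 : Set (Set E)) (X : Set E) : Prop where
  sUnion_eq : ⋃₀ 𝒮 = X
  pairwiseDisjoint : 𝒮.PairwiseDisjoint id
  locallyFinite : ∀ x ∈ X, ∃ U ∈ 𝓝 x, {S ∈ 𝒮 | (S ∩ U).Nonempty}.Finite
  isSubmanifold : ∀ S ∈ 𝒮, IsSubmanifold S
  regular : ∀ A ∈ 𝒮, ∀ B ∈ 𝒮, A ≠ B → ∀ x ∈ A, IsWhitneyRegularAt B A x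

end WhitneyStrat

end

namespace WhitneyStrat

open Filter

section

variable {E F : Type*} [NormedAddCommGroup E] [InnerProductSpace ℝ E] [FiniteDimensional ℝ E]
  [NormedAddCommGroup F] [InnerProductSpace ℝ F] [FiniteDimensional ℝ F]

/-! Only regularity is delicate. Let `a k ∈ S ∩ φ⁻¹ T` and `b k ∈ S' ∩ φ⁻¹ T'` tend to `x`, with
rescaled secants tending to `v`. By compactness of the Grassmannian, along a subsequence the tangent
spaces of `S'` at `b k` tend to some `Q` and those of `T'` at `φ (b k)` to some `R`. Regularity of
`S'` over `S` gives `v ∈ Q`; strict differentiability of `φ` and regularity of `T'` over `T` give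
`dφ_x v ∈ R`. It remains to see that the limit `P` of the tangent spaces of `S' ∩ φ⁻¹ T'` contains
`Q ∩ dφ_x⁻¹ R`. Condition (b) implies (a), so `Q` contains `T_x S`, which `dφ_x` maps onto the
target; this transversality gives the inclusion (`inf_comap_le_of_grassTendsto`). Condition (b) is
used in a vector form that allows `a k = b k`, since `φ` may identify the two points. -/

omit [FiniteDimensional ℝ E] [FiniteDimensional ℝ F] in
theorem tendsto_clm_apply {A : ℕ → E →L[ℝ] F} {A' : E →L[ℝ] F} {v : ℕ → E} {w : E}
    (hA : Tendsto A atTop (𝓝 A')) (hv : Tendsto v atTop (𝓝 w)) :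
    Tendsto (fun k => A k (v k)) atTop (𝓝 (A' w)) :=
  (isBoundedBilinearMap_apply.continuous.tendsto (A', w)).comp (hA.prodMk_nhds hv)

omit [FiniteDimensional ℝ E] [FiniteDimensional ℝ F] in
theorem tendsto_clm_comp {G : Type*} [NormedAddCommGroup G] [NormedSpace ℝ G]
    {B : ℕ → E →L[ℝ] F} {B' : E →L[ℝ] F} {A : ℕ → G →L[ℝ] E} {A' : G →L[ℝ] E}
    (hB : Tendsto B atTop (𝓝 B')) (hA : Tendsto A atTop (𝓝 A')) :
    Tendsto (fun k => B k ∘L A k) atTop (𝓝 (B' ∘L A')) :=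
  (isBoundedBilinearMap_comp.continuous.tendsto (B', A')).comp (hB.prodMk_nhds hA)

omit [FiniteDimensional ℝ E] in
/-- Surjectivity is an open condition on continuous linear maps. -/
theorem eventually_surjective {A : E →L[ℝ] F} (hA : Function.Surjective A) :
    ∀ᶠ B : E →L[ℝ] F in 𝓝 A, Function.Surjective B := by
  have : CompleteSpace F := FiniteDimensional.complete ℝ F
  obtain ⟨N, hN⟩ := A.exists_rightInverse_of_surjective (LinearMap.range_eq_top.2 hA)
  have h1 : Tendsto (fun B : E →L[ℝ] F => B ∘L N) (𝓝 A) (𝓝 (1 : F →L[ℝ] F)) := by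
    have h : Continuous (fun B : E →L[ℝ] F => B ∘L N) := by fun_prop
    have h' := h.tendsto A
    rwa [hN] at h'
  refine (h1.eventually (Units.isOpen.mem_nhds (isUnit_one (M := F →L[ℝ] F)))).mono
    fun B hB => ?_
  intro y
  obtain ⟨u, hu⟩ := hB
  refine ⟨N (u⁻¹.val y), ?_⟩
  have h2 := congrArg (fun T : F →L[ℝ] F => T y) u.mul_inv
  rw [hu] at h2
  exact h2

/-! ### Limits of subspaces -/

/-- A limit of vectors of `P k` belongs to the limit of the subspaces `P k`. -/
theorem GrassTendsto.mem_of_tendsto {P : ℕ → Submodule ℝ E} {Q : Submodule ℝ E}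
    (hP : GrassTendsto P Q) {v : ℕ → E} {w : E} (hv : ∀ᶠ k in atTop, v k ∈ P k)
    (hvw : Tendsto v atTop (𝓝 w)) : w ∈ Q := by
  rw [← Submodule.starProjection_eq_self_iff]
  refine tendsto_nhds_unique (tendsto_clm_apply hP hvw) (hvw.congr' ?_)
  filter_upwards [hv] with k hk
  exact (Submodule.starProjection_eq_self_iff.2 hk).symm

theorem GrassTendsto.tendsto_starProjection {P : ℕ → Submodule ℝ E} {Q : Submodule ℝ E}
    (hP : GrassTendsto P Q) {v : E} (hv : v ∈ Q) :
    Tendsto (fun k => (P k).starProjection v) atTop (𝓝 v) := by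
  have h := tendsto_clm_apply hP (tendsto_const_nhds (x := v))
  rwa [Submodule.starProjection_eq_self_iff.2 hv] at h

/-- Sequential compactness of the Grassmannian. -/
theorem exists_subseq_grassTendsto (P : ℕ → Submodule ℝ E) :
    ∃ (Q : Submodule ℝ E) (s : ℕ → ℕ), StrictMono s ∧ GrassTendsto (P ∘ s) Q := by
  have : CompleteSpace E := FiniteDimensional.complete ℝ E
  have : ProperSpace (E →L[ℝ] E) := FiniteDimensional.proper ℝ _
  obtain ⟨p, -, s, hs, hp⟩ := tendsto_subseq_of_bounded
    (Metric.isBounded_closedBall (x := (0 : E →L[ℝ] E)) (r := 1))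
    (x := fun k => (P k).starProjection)
    (fun k => by simpa using (P k).starProjection_norm_le)
  -- Being idempotent and self-adjoint is a closed condition, so the limit operator is again an
  -- orthogonal projection.
  have hstar : IsStarProjection p := by
    have h1 : ∀ k, IsStarProjection ((P k).starProjection) := fun k => by simp
    refine ⟨?_, ?_⟩
    · refine tendsto_nhds_unique (hp.mul hp) (hp.congr fun k => ?_)
      exact ((h1 (s k)).isIdempotentElem).symm
    · refine tendsto_nhds_unique hp.star (hp.congr fun k => ?_)
      exact ((h1 (s k)).isSelfAdjoint).symm
  obtain ⟨K, _, rfl⟩ := isStarProjection_iff_eq_starProjection.1 hstar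
  exact ⟨K, s, hs, hp⟩

theorem GrassTendsto.comp {P : ℕ → Submodule ℝ E} {Q : Submodule ℝ E} (hP : GrassTendsto P Q)
    {s : ℕ → ℕ} (hs : Tendsto s atTop atTop) : GrassTendsto (P ∘ s) Q :=
  Tendsto.comp hP hs

/-- If the nonzero vector `v` is the limit of multiples of `w k`, the lines through `w k` converge
to the line through `v`. -/
theorem grassTendsto_span_singleton {w : ℕ → E} {c : ℕ → ℝ} {v : E} (hv : v ≠ 0)
    (h : Tendsto (fun k => c k • w k) atTop (𝓝 v)) :
    GrassTendsto (fun k => Submodule.span ℝ {w k}) (Submodule.span ℝ {v}) := by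
  have key : ∀ u : E, (Submodule.span ℝ {u}).starProjection =
      (‖u‖ ^ 2)⁻¹ • (innerSL ℝ u).smulRight u := fun u => by
    ext y
    rw [Submodule.starProjection_singleton]
    simp [smul_smul, div_eq_inv_mul]
  unfold GrassTendsto
  have hc : Continuous fun u : E => (innerSL ℝ u).smulRight u :=
    (ContinuousLinearMap.smulRightL ℝ E E).continuous₂.comp
      ((innerSL ℝ).continuous.prodMk continuous_id)
  have h1 : Tendsto (fun k => (Submodule.span ℝ {c k • w k}).starProjection) atTop
      (𝓝 (Submodule.span ℝ {v}).starProjection) := by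
    simp only [key]
    exact ((h.norm.pow 2).inv₀ (by simpa using hv)).smul ((hc.tendsto v).comp h)
  refine h1.congr' ?_
  filter_upwards [h.eventually_ne hv] with k hk
  have hck : c k ≠ 0 := fun h0 => hk (by simp [h0])
  simp only [Submodule.span_singleton_smul_eq hck.isUnit]

/-- Transversal intersections are lower semicontinuous: if `A` maps `Q` onto the target, each
vector of `Q ⊓ A⁻¹ R` is a limit of vectors of `Q k ⊓ (A k)⁻¹ (R k)`. -/
theorem inf_comap_le_of_grassTendsto {A : ℕ → E →L[ℝ] F} {A' : E →L[ℝ] F}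
    {Q P : ℕ → Submodule ℝ E} {Q' P' : Submodule ℝ E} {R : ℕ → Submodule ℝ F}
    {R' : Submodule ℝ F} (hA : Tendsto A atTop (𝓝 A')) (hQ : GrassTendsto Q Q')
    (hR : GrassTendsto R R') (hP : GrassTendsto P P')
    (hle : ∀ᶠ k in atTop, Q k ⊓ (R k).comap (A k : E →ₗ[ℝ] F) ≤ P k)
    (hsurj : Q'.map (A' : E →ₗ[ℝ] F) = ⊤) : Q' ⊓ R'.comap (A' : E →ₗ[ℝ] F) ≤ P' := by
  have : CompleteSpace F := FiniteDimensional.complete ℝ F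
  rintro v ⟨hvQ, hvR⟩
  have hvR : A' v ∈ R' := hvR
  have hM : Function.Surjective (A' ∘L Q'.starProjection) := fun y => by
    obtain ⟨q, hq, rfl⟩ : y ∈ Q'.map (A' : E →ₗ[ℝ] F) := hsurj ▸ trivial
    exact ⟨q, congrArg A' (Submodule.starProjection_eq_self_iff.2 hq)⟩
  obtain ⟨N, hN⟩ := ContinuousLinearMap.exists_rightInverse_of_surjective _
    (LinearMap.range_eq_top.2 hM)
  have hMN : Tendsto (fun k => (A k ∘L (Q k).starProjection) ∘L N) atTop
      (𝓝 (1 : F →L[ℝ] F)) := by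
    have := tendsto_clm_comp (tendsto_clm_comp hA hQ) (tendsto_const_nhds (x := N))
    rwa [hN] at this
  have hinv : Tendsto (fun k => Ring.inverse ((A k ∘L (Q k).starProjection) ∘L N)) atTop
      (𝓝 (1 : F →L[ℝ] F)) := by
    have := (NormedRing.inverse_continuousAt (1 : (F →L[ℝ] F)ˣ)).tendsto
    rw [Units.val_one, Ring.inverse_one] at this
    exact this.comp hMN
  have hq := hQ.tendsto_starProjection hvQ
  have hAq := tendsto_clm_apply hA hq
  -- The defect of `(Q k).starProjection v` from lying in `(A k)⁻¹ (R k)`. It tends to `0`, and `N`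
  -- followed by the projection to `Q k`, with `hinv` making it an exact right inverse of `A k` for
  -- large `k`, lifts it to a small correction inside `Q k`.
  have hw : Tendsto (fun k => A k ((Q k).starProjection v) -
      (R k).starProjection (A k ((Q k).starProjection v))) atTop (𝓝 0) := by
    have := hAq.sub (tendsto_clm_apply hR hAq)
    rwa [Submodule.starProjection_eq_self_iff.2 hvR, sub_self] at this
  have hu := tendsto_clm_apply hQ
    (tendsto_clm_apply (tendsto_const_nhds (x := N)) (tendsto_clm_apply hinv hw))
  have hlim := hq.sub hu
  simp only [map_zero, sub_zero] at hlim
  refine hP.mem_of_tendsto ?_ hlim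
  filter_upwards [hle, hMN.eventually (Units.isOpen.mem_nhds (isUnit_one (M := F →L[ℝ] F)))]
    with k hk hunit
  refine hk ⟨sub_mem (Submodule.starProjection_apply_mem _ _)
    (Submodule.starProjection_apply_mem _ _), ?_⟩
  have h1 : ∀ y, A k ((Q k).starProjection
      (N (Ring.inverse ((A k ∘L (Q k).starProjection) ∘L N) y))) = y := fun y =>
    congrArg (fun T : F →L[ℝ] F => T y) (Ring.mul_inverse_cancel _ hunit)
  change A k (_ - _) ∈ R k
  rw [map_sub, h1, sub_sub_cancel]
  exact Submodule.starProjection_apply_mem _ _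

/-! ### Secant vectors and Whitney's conditions -/

omit [FiniteDimensional ℝ E] [FiniteDimensional ℝ F] in
/-- Strict differentiability carries limits of secant vectors to limits of secant vectors. -/
theorem tendsto_smul_sub_of_hasStrictFDerivAt {f : E → F} {f' : E →L[ℝ] F} {x : E}
    (hf : HasStrictFDerivAt f f' x) {a b : ℕ → E} {c : ℕ → ℝ} {v : E}
    (ha : Tendsto a atTop (𝓝 x)) (hb : Tendsto b atTop (𝓝 x))
    (hv : Tendsto (fun k => c k • (a k - b k)) atTop (𝓝 v)) :
    Tendsto (fun k => c k • (f (a k) - f (b k))) atTop (𝓝 (f' v)) := by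
  have h1 := hf.isLittleO.comp_tendsto (ha.prodMk_nhds hb)
  have h2 := (Asymptotics.isBigO_refl c atTop).smul_isLittleO h1
  have h3 : Tendsto (fun k => c k • (f (a k) - f (b k) - f' (a k - b k))) atTop (𝓝 0) :=
    (Asymptotics.isLittleO_one_iff ℝ).1 (h2.trans_isBigO (hv.isBigO_one ℝ))
  have h4 := h3.add ((f'.continuous.tendsto v).comp hv)
  rw [zero_add] at h4
  refine h4.congr fun k => ?_
  simp [smul_sub]

/-- Whitney's condition (b) in terms of limits of multiples of the secant vectors. -/
def IsVectorRegularAt (B A : Set E) (x : E) : Prop :=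
  ∀ (a b : ℕ → E) (c : ℕ → ℝ) (v : E) (P : Submodule ℝ E),
    (∀ k, a k ∈ A) → (∀ k, b k ∈ B) → Tendsto a atTop (𝓝 x) → Tendsto b atTop (𝓝 x) →
    Tendsto (fun k => c k • (a k - b k)) atTop (𝓝 v) →
    GrassTendsto (fun k => tangentSpace B (b k)) P → v ∈ P

/-- A nonzero `v` forces `a k ≠ b k` eventually and makes the secant lines converge to `ℝ v`.
Conversely, a vector of the limit line is the limit of its projections to the secant lines, which
are multiples of `a k - b k`. -/
theorem isWhitneyRegularAt_iff {A B : Set E} {x : E} :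
    IsWhitneyRegularAt B A x ↔ IsVectorRegularAt B A x := by
  constructor
  · intro h a b c v P haA hbB ha hb hv hP
    by_cases h0 : v = 0
    · simp [h0]
    obtain ⟨N, hN⟩ := eventually_atTop.1 (hv.eventually_ne h0)
    have hs : Tendsto (fun k => k + N) atTop atTop := tendsto_add_atTop_nat N
    refine h (fun k => a (k + N)) (fun k => b (k + N)) (Submodule.span ℝ {v}) P (fun _ => haA _)
      (fun _ => hbB _) (fun k hk => hN (k + N) (by omega) (by simp [hk])) (ha.comp hs)
      (hb.comp hs) ((grassTendsto_span_singleton h0 hv).comp hs) (hP.comp hs)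
      (Submodule.mem_span_singleton_self v)
  · intro h a b L P haA hbB _ ha hb hL hP l hl
    have h1 := hL.tendsto_starProjection hl
    choose c hc using fun k => Submodule.mem_span_singleton.1
      (Submodule.starProjection_apply_mem (Submodule.span ℝ {a k - b k}) l)
    exact h a b c l P haA hbB ha hb (h1.congr fun k => (hc k).symm) hP

/-- Whitney's condition (b) implies Whitney's condition (a). -/
theorem IsVectorRegularAt.tangentSpace_le {A B : Set E} {x : E} (h : IsVectorRegularAt B A x)
    {b : ℕ → E} {P : Submodule ℝ E} (hbB : ∀ k, b k ∈ B) (hb : Tendsto b atTop (𝓝 x))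
    (hP : GrassTendsto (fun k => tangentSpace B (b k)) P) : tangentSpace A x ≤ P := by
  refine Submodule.span_le.2 fun v hv => ?_
  obtain ⟨c, d, hd, hdA, hcd⟩ := mem_tangentConeAt_iff_exists_seq.1 hv
  obtain ⟨N, hN⟩ := eventually_atTop.1 hdA
  -- Choosing `b k` so close to `x` that even `c j • (b k - x)` is negligible, the secants from `b
  -- k` to `x + d j` have the same rescaled limit `v` as `d j`.
  have hsel : ∀ j : ℕ, ∃ k ≥ j, ‖c j • (b k - x)‖ < 1 / ((j : ℝ) + 1) := fun j => by
    have h1 : Tendsto (fun k => ‖c j • (b k - x)‖) atTop (𝓝 0) := by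
      simpa using ((hb.sub_const x).const_smul (c j)).norm
    exact ((eventually_ge_atTop j).and (h1.eventually_lt_const Nat.one_div_pos_of_nat)).exists
  choose k hk hck using hsel
  have hkt : Tendsto k atTop atTop := tendsto_atTop_mono hk tendsto_id
  have hs : Tendsto (fun j => j + N) atTop atTop := tendsto_add_atTop_nat N
  have ha : Tendsto (fun j => x + d j) atTop (𝓝 x) := by simpa using hd.const_add x
  have hc0 : Tendsto (fun j => c j • (b (k j) - x)) atTop (𝓝 0) :=
    squeeze_zero_norm (fun j => (hck j).le) tendsto_one_div_add_atTop_nhds_zero_nat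
  refine h (fun j => x + d (j + N)) (fun j => b (k (j + N))) (fun j => c (j + N)) v P
    (fun j => hN _ (by omega)) (fun _ => hbB _) (ha.comp hs) (hb.comp (hkt.comp hs)) ?_
    (hP.comp (hkt.comp hs))
  have h2 := (hcd.sub hc0).comp hs
  rw [sub_zero] at h2
  refine h2.congr fun j => ?_
  simp only [Function.comp_apply, ← smul_sub]
  congr 1
  abel

/-- A submanifold satisfies Whitney's condition (b) over itself. -/
theorem IsSubmanifold.isVectorRegularAt {B : Set E} (hB : IsSubmanifold B) {x : E} (hx : x ∈ B) :
    IsVectorRegularAt B B x := by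
  intro a b c v P haB hbB ha hb hv hP
  obtain ⟨n, hB⟩ := hB
  obtain ⟨U, g, hU, hxU, hg, hs, hBU⟩ := hB x hx
  have hgx := hg.contDiffAt (hU.mem_nhds hxU)
  have haU := ha.eventually (hU.mem_nhds hxU)
  have hbU := hb.eventually (hU.mem_nhds hxU)
  have hzero : ∀ y ∈ B, y ∈ U → g y = 0 := fun y hy hyU => by
    have : y ∈ B ∩ U := ⟨hy, hyU⟩
    rw [hBU] at this
    exact this.2
  have hgv : fderiv ℝ g x v = 0 := by
    refine tendsto_nhds_unique (tendsto_smul_sub_of_hasStrictFDerivAt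
      (hgx.hasStrictFDerivAt (by simp)) ha hb hv) (tendsto_const_nhds.congr' ?_)
    filter_upwards [haU, hbU] with k h1 h2
    simp [hzero _ (haB k) h1, hzero _ (hbB k) h2]
  -- With `⊤` and `⊥` as constant sequences, this says that kernels of surjective differentials vary
  -- semicontinuously.
  refine inf_comap_le_of_grassTendsto (A := fun k => fderiv ℝ g (b k)) (A' := fderiv ℝ g x)
    (Q := fun _ => ⊤) (Q' := ⊤) (R := fun _ => ⊥) (R' := ⊥)
    (((hgx.continuousAt_fderiv (by simp)).tendsto).comp hb) tendsto_const_nhds tendsto_const_nhds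
    hP ?_ (by rw [Submodule.map_top]; exact LinearMap.range_eq_top.2 (hs x hxU))
    ⟨trivial, by simpa using hgv⟩
  filter_upwards [hbU] with k hk
  rw [(tangentSpace_eq_ker hU ⟨hbB k, hk⟩ hg hs hBU).2, LinearMap.ker, top_inf_eq]

/-! ### The strata `S ∩ φ⁻¹ T` -/

/-- A local equation of `S ∩ φ⁻¹ T`, where `φ` restricts to a submersion on `S`. -/
theorem exists_equation_inter_preimage {φ : E → F} {V : Set E} (hV : IsOpen V)
    (hφ : ContDiffOn ℝ ∞ φ V) {S : Set E} {T : Set F} {c d : ℕ}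
    (hS : IsSubmanifoldOfCodim c S) (hT : IsSubmanifoldOfCodim d T) (hsub : IsSubmersiveOn φ S)
    {x : E} (hxV : x ∈ V) (hxS : x ∈ S) (hxT : φ x ∈ T) :
    ∃ (U : Set E) (g : E → EuclideanSpace ℝ (Fin (c + d))),
      IsOpen U ∧ x ∈ U ∧ ContDiffOn ℝ ∞ g U ∧
      (∀ y ∈ U, Function.Surjective (fderiv ℝ g y)) ∧ (S ∩ φ ⁻¹' T) ∩ U = {y ∈ U | g y = 0} ∧
      LinearMap.ker (fderiv ℝ g x : E →ₗ[ℝ] EuclideanSpace ℝ (Fin (c + d))) =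
        tangentSpace S x ⊓ (tangentSpace T (φ x)).comap (fderiv ℝ φ x : E →ₗ[ℝ] F) := by
  obtain ⟨U₁, g, hU₁, hxU₁, hg, hgs, hSU⟩ := hS x hxS
  obtain ⟨U₂, h, hU₂, hxU₂, hh, hhs, hTU⟩ := hT (φ x) hxT
  have hTS := (tangentSpace_eq_ker hU₁ ⟨hxS, hxU₁⟩ hg hgs hSU).2
  have hTT := (tangentSpace_eq_ker hU₂ ⟨hxT, hxU₂⟩ hh hhs hTU).2
  let e : (EuclideanSpace ℝ (Fin c) × EuclideanSpace ℝ (Fin d)) ≃L[ℝ]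
      EuclideanSpace ℝ (Fin (c + d)) := ContinuousLinearEquiv.ofFinrankEq (by simp)
  let G : E → EuclideanSpace ℝ (Fin (c + d)) := fun y => e (g y, h (φ y))
  let U₀ := U₁ ∩ (V ∩ φ ⁻¹' U₂)
  have hU₀ : IsOpen U₀ := hU₁.inter (hφ.continuousOn.isOpen_inter_preimage hV hU₂)
  have hxU₀ : x ∈ U₀ := ⟨hxU₁, hxV, hxU₂⟩
  have hG : ContDiffOn ℝ ∞ G U₀ :=
    e.contDiff.comp_contDiffOn ((hg.mono fun y hy => hy.1).prodMk
      (hh.comp (hφ.mono fun y hy => hy.2.1) fun y hy => hy.2.2))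
  have hgx := (hg.contDiffAt (hU₁.mem_nhds hxU₁)).differentiableAt (by simp)
  have hhx := (hh.contDiffAt (hU₂.mem_nhds hxU₂)).differentiableAt (by simp)
  have hφx := (hφ.contDiffAt (hV.mem_nhds hxV)).differentiableAt (by simp)
  have hderiv : ∀ v, fderiv ℝ G x v =
      e (fderiv ℝ g x v, fderiv ℝ h (φ x) (fderiv ℝ φ x v)) := fun v => by
    have h1 := (e : _ →L[ℝ] EuclideanSpace ℝ (Fin (c + d))).hasFDerivAt.comp x
      (hgx.hasFDerivAt.prodMk (hhx.hasFDerivAt.comp x hφx.hasFDerivAt))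
    have h2 : fderiv ℝ G x = _ := h1.fderiv
    rw [h2]
    rfl
  have hsurj : Function.Surjective (fderiv ℝ G x) := fun z => by
    obtain ⟨⟨p, q⟩, rfl⟩ := e.surjective z
    obtain ⟨u, rfl⟩ := hgs x hxU₁ p
    -- The second component is corrected by a vector tangent to `S`, which leaves the first
    -- component unchanged; it exists because `φ` is submersive on `S`.
    obtain ⟨w, hw⟩ := hhs _ hxU₂ (q - fderiv ℝ h (φ x) (fderiv ℝ φ x u))
    obtain ⟨u', hu', rfl⟩ : w ∈ (tangentSpace S x).map (fderiv ℝ φ x : E →ₗ[ℝ] F) :=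
      hsub x hxS ▸ trivial
    rw [hTS] at hu'
    have hu' : fderiv ℝ g x u' = 0 := hu'
    have hw : fderiv ℝ h (φ x) (fderiv ℝ φ x u') = _ := hw
    exact ⟨u + u', by rw [hderiv]; simp [hu', hw]⟩
  have hnear : ∀ᶠ y in 𝓝 x, y ∈ U₀ ∧ Function.Surjective (fderiv ℝ G y) :=
    (hU₀.eventually_mem hxU₀).and (((hG.contDiffAt (hU₀.mem_nhds hxU₀)).continuousAt_fderiv
      (by simp)).eventually (eventually_surjective hsurj))
  obtain ⟨U, hU, hUo, hxU⟩ := eventually_nhds_iff.1 hnear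
  refine ⟨U, G, hUo, hxU, hG.mono fun y hy => (hU y hy).1, fun y hy => (hU y hy).2, ?_, ?_⟩
  · ext y
    rw [Set.inter_comm, Set.mem_inter_iff, Set.mem_ofPred_eq]
    refine and_congr_right fun hy => ?_
    obtain ⟨hy₁, -, hy₂⟩ := (hU y hy).1
    have h1 : y ∈ S ↔ g y = 0 := by simpa [hy₁] using Set.ext_iff.1 hSU y
    have h2 : φ y ∈ T ↔ h (φ y) = 0 := by
      simpa [show φ y ∈ U₂ from hy₂] using Set.ext_iff.1 hTU (φ y)
    simp [G, h1, h2, Prod.ext_iff]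
  · ext v
    rw [hTS, hTT]
    simp [hderiv, Prod.ext_iff]

theorem IsSubmanifold.inter_preimage {φ : E → F} {V : Set E} (hV : IsOpen V)
    (hφ : ContDiffOn ℝ ∞ φ V) {S : Set E} {T : Set F} (hSV : S ⊆ V)
    (hS : IsSubmanifold S) (hT : IsSubmanifold T) (hsub : IsSubmersiveOn φ S) :
    IsSubmanifold (S ∩ φ ⁻¹' T) := by
  obtain ⟨c, hS⟩ := hS
  obtain ⟨d, hT⟩ := hT
  refine ⟨c + d, fun x hx => ?_⟩
  obtain ⟨U, g, hU, hxU, hg, hs, hSTU, -⟩ :=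
    exists_equation_inter_preimage hV hφ hS hT hsub (hSV hx.1) hx.1 hx.2
  exact ⟨U, g, hU, hxU, hg, hs, hSTU⟩

theorem tangentSpace_inter_preimage {φ : E → F} {V : Set E} (hV : IsOpen V)
    (hφ : ContDiffOn ℝ ∞ φ V) {S : Set E} {T : Set F} (hSV : S ⊆ V)
    (hS : IsSubmanifold S) (hT : IsSubmanifold T) (hsub : IsSubmersiveOn φ S) {x : E}
    (hx : x ∈ S ∩ φ ⁻¹' T) : tangentSpace (S ∩ φ ⁻¹' T) x =
      tangentSpace S x ⊓ (tangentSpace T (φ x)).comap (fderiv ℝ φ x : E →ₗ[ℝ] F) := by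
  obtain ⟨c, hS⟩ := hS
  obtain ⟨d, hT⟩ := hT
  obtain ⟨U, g, hU, hxU, hg, hs, hSTU, hker⟩ :=
    exists_equation_inter_preimage hV hφ hS hT hsub (hSV hx.1) hx.1 hx.2
  rw [(tangentSpace_eq_ker hU ⟨hx, hxU⟩ hg hs hSTU).2, hker]

/-- Whitney's condition (b) is inherited by intersections with preimages under a map that is
submersive on the strata. -/
theorem IsVectorRegularAt.inter_preimage {φ : E → F} {V : Set E} (hV : IsOpen V)
    (hφ : ContDiffOn ℝ ∞ φ V) {S S' : Set E} {T T' : Set F} (hSV' : S' ⊆ V)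
    (hS' : IsSubmanifold S') (hT' : IsSubmanifold T') (hsub : IsSubmersiveOn φ S)
    (hsub' : IsSubmersiveOn φ S') {x : E} (hxV : x ∈ V) (hxS : x ∈ S)
    (hSS' : IsVectorRegularAt S' S x) (hTT' : IsVectorRegularAt T' T (φ x)) :
    IsVectorRegularAt (S' ∩ φ ⁻¹' T') (S ∩ φ ⁻¹' T) x := by
  intro a b c v P haA hbB ha hb hv hP
  have hφx := hφ.contDiffAt (hV.mem_nhds hxV)
  obtain ⟨Q, s, hs, hQ⟩ := exists_subseq_grassTendsto fun k => tangentSpace S' (b k)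
  obtain ⟨R, t, ht, hR⟩ := exists_subseq_grassTendsto fun k => tangentSpace T' (φ (b (s k)))
  have hst := hs.tendsto_atTop.comp ht.tendsto_atTop
  replace hQ := hQ.comp ht.tendsto_atTop
  have ha' := ha.comp hst
  have hb' := hb.comp hst
  have hv' := hv.comp hst
  refine inf_comap_le_of_grassTendsto (A := fun k => fderiv ℝ φ (b (s (t k))))
    (((hφx.continuousAt_fderiv (by simp)).tendsto).comp hb') hQ hR (hP.comp hst)
    (Eventually.of_forall fun k => ?_) ?_ ⟨?_, ?_⟩
  · exact (tangentSpace_inter_preimage hV hφ hSV' hS' hT' hsub' (hbB _)).ge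
  · rw [eq_top_iff, ← hsub x hxS]
    exact Submodule.map_mono (hSS'.tangentSpace_le (fun k => (hbB (s (t k))).1) hb' hQ)
  · exact hSS' _ _ _ v Q (fun k => (haA (s (t k))).1) (fun k => (hbB (s (t k))).1) ha' hb' hv' hQ
  · exact hTT' _ _ _ _ R (fun k => (haA (s (t k))).2) (fun k => (hbB (s (t k))).2)
      (hφx.continuousAt.tendsto.comp ha') (hφx.continuousAt.tendsto.comp hb')
      (tendsto_smul_sub_of_hasStrictFDerivAt (hφx.hasStrictFDerivAt (by simp)) ha' hb' hv') hR

/-- In a Whitney stratification every stratum, itself included, satisfies the vector form of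
Whitney's condition (b) over every stratum. -/
theorem IsWhitneyStratification.isVectorRegularAt {𝒮 : Set (Set E)} {X : Set E}
    (h : IsWhitneyStratification 𝒮 X) {A B : Set E} (hA : A ∈ 𝒮) (hB : B ∈ 𝒮) {x : E}
    (hx : x ∈ A) : IsVectorRegularAt B A x := by
  rcases eq_or_ne A B with rfl | hAB
  · exact (h.isSubmanifold A hA).isVectorRegularAt hx
  · exact isWhitneyRegularAt_iff.1 (h.regular A hA B hB hAB x hx)

end

end WhitneyStrat

/-! ### The induced stratification -/

theorem mainTheorem5 (n m : ℕ)
    (V : Set (EuclideanSpace ℝ (Fin n))) (W : Set (EuclideanSpace ℝ (Fin m)))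
    (hV : IsOpen V) (hW : IsOpen W)
    (φ : EuclideanSpace ℝ (Fin n) → EuclideanSpace ℝ (Fin m))
    (hφ : ContDiffOn ℝ ∞ φ V) (hφVW : Set.MapsTo φ V W)
    (X : Set (EuclideanSpace ℝ (Fin n))) (hXV : X ⊆ V)
    (𝒮 : Set (Set (EuclideanSpace ℝ (Fin n)))) (𝒯 : Set (Set (EuclideanSpace ℝ (Fin m))))
    (h𝒮 : WhitneyStrat.IsWhitneyStratification 𝒮 X)
    (hsub : ∀ S ∈ 𝒮, WhitneyStrat.IsSubmersiveOn φ S)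
    (h𝒯 : WhitneyStrat.IsWhitneyStratification 𝒯 W) :
    WhitneyStrat.IsWhitneyStratification
      {A | ∃ S ∈ 𝒮, ∃ T ∈ 𝒯, A = S ∩ φ ⁻¹' T} X := by
  have hSX : ∀ S ∈ 𝒮, S ⊆ X := fun S hS => h𝒮.sUnion_eq ▸ Set.subset_sUnion_of_mem hS
  constructor
  · ext x
    simp only [Set.mem_sUnion, Set.mem_ofPred_eq]
    constructor
    · rintro ⟨_, ⟨S, hS, T, -, rfl⟩, hx⟩
      exact hSX S hS hx.1
    · intro hx
      obtain ⟨S, hS, hxS⟩ : x ∈ ⋃₀ 𝒮 := h𝒮.sUnion_eq ▸ hx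
      obtain ⟨T, hT, hxT⟩ : φ x ∈ ⋃₀ 𝒯 := h𝒯.sUnion_eq ▸ hφVW (hXV hx)
      exact ⟨_, ⟨S, hS, T, hT, rfl⟩, hxS, hxT⟩
  · rintro _ ⟨S, hS, T, hT, rfl⟩ _ ⟨S', hS', T', hT', rfl⟩ hne
    refine Set.disjoint_left.2 fun x hx hx' => hne ?_
    rw [h𝒮.pairwiseDisjoint.elim_set hS hS' x hx.1 hx'.1,
      h𝒯.pairwiseDisjoint.elim_set hT hT' (φ x) hx.2 hx'.2]
  · intro x hx
    obtain ⟨U, hU, hUf⟩ := h𝒮.locallyFinite x hx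
    obtain ⟨U', hU', hUf'⟩ := h𝒯.locallyFinite (φ x) (hφVW (hXV hx))
    have hφc := (hφ.contDiffAt (hV.mem_nhds (hXV hx))).continuousAt
    refine ⟨U ∩ φ ⁻¹' U', Filter.inter_mem hU (hφc hU'),
      (hUf.image2 (fun S T => S ∩ φ ⁻¹' T) hUf').subset ?_⟩
    rintro _ ⟨⟨S, hS, T, hT, rfl⟩, y, ⟨hyS, hyT⟩, hyU, hyU'⟩
    exact ⟨S, ⟨hS, y, hyS, hyU⟩, T, ⟨hT, φ y, hyT, hyU'⟩, rfl⟩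
  · rintro _ ⟨S, hS, T, hT, rfl⟩
    exact (h𝒮.isSubmanifold S hS).inter_preimage hV hφ ((hSX S hS).trans hXV)
      (h𝒯.isSubmanifold T hT) (hsub S hS)
  -- Distinct new strata may still have `S = S'` or `T = T'`, so regularity of a stratum over itself
  -- is needed as well.
  · rintro _ ⟨S, hS, T, hT, rfl⟩ _ ⟨S', hS', T', hT', rfl⟩ - x hx
    exact WhitneyStrat.isWhitneyRegularAt_iff.2
      (WhitneyStrat.IsVectorRegularAt.inter_preimage hV hφ ((hSX S' hS').trans hXV)
        (h𝒮.isSubmanifold S' hS') (h𝒯.isSubmanifold T' hT') (hsub S hS) (hsub S' hS')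
        (hXV (hSX S hS hx.1)) hx.1 (h𝒮.isVectorRegularAt hS hS' hx.1)
        (h𝒯.isVectorRegularAt hT hT' hx.2))
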